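/- Let $X$ be a nonempty, bounded, complete metric space with metric $\mu$, and let $D$ be a finite set of contractions $d\colon X\to X$ (called digits) with $\bigcup_{d\in D} d[X]=X$. For a digit stream $\alpha=\alpha_0\alpha_1\ldots\in D^\omega$ let $[\![\alpha]\!]\in X$ be the unique element of $\bigcap_{n}(\alpha_0\circ\cdots\circ\alpha_{n-1})[X]$. Let $Q=\{u_0,u_1,\ldots\}$ be a dense subset of $X$ given with an enumeration (repetitions are allowed), the elements of which are called basic points. Computability for basic points refers to their indices; digits and rationals are coded canonically. A sequence $w=(w_n)_{n\in\mathbb N}\in Q^\omega$ is given by a sequence of indices. Assume that: 1. *($(X,D,Q)$ is a computable digit space.)* The sets $\{(u,v,r)\in Q\times Q\times\mathbb{Q}\mid \mu(u,v)<r\}$ and $\{(u,v,r)\in Q\times Q\times\mathbb{Q}\mid\mu(u,v)>r\}$ are computably enumerable, and each $d\in D$ is computable: it has a computable modulus of uniform continuity, and from $u\in Q$ and $n\in\mathbb{N}$ one can compute some $v\in Q$ with $\mu(d(u),v)<2^{-n}$. 2. *(Well-covering.)* Every $x\in X$ lies in the interior of $d[X]$ for some $d\in D$. 3. *(Decidable.)*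 For $u\in Q$, rational $\theta>0$ and $d\in D$ it is decidable whether the open ball $B_\mu(u,\theta)$ is contained in $d[X]$. 4. *(Approximable choice.)* For every $d\in D$ there is an effective procedure that maps a rational $\theta>0$ and $u\in d[X]\cap Q$ to some $v_u^\theta\in Q$ such that, for all rational $\theta,\bar\theta>0$: (a) $\mu(v_u^\theta,v_u^{\bar\theta})<\max\{\theta,\bar\theta\}$ for all $u\in d[X]\cap Q$; (b) one can compute from $\theta$ a rational $\theta'>0$ such that $\mu(v_u^\theta,v_{u'}^\theta)<\theta$ for all $u,u'\in d[X]\cap Q$ with $\mu(u,u')<\theta'$; (c) for every $u\in d[X]\cap Q$ there is some $z\in X$ with $d(z)=u$ and $\mu(z,v_u^\theta)<\theta$. Let $\rho_C$ be the Cauchy representation, that is, the partial map from $Q^\omega$ to $X$ with $\rho_C(w)=x$ if and only if $\mu(x,w_n)<2^{-n}$ for all $n\in\mathbb{N}$. Then there are a total computable operator $F\colon D^\omega\to Q^\omega$ and a partial computable operator $G$ from $Q^\omega$ to $D^\omega$ with $\operatorname{dom}(G)=\operatorname{dom}(\rho_C)$ such that $$\rho_C(F(\alpha))=[\![\alpha]\!]\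 \text{ for all } \alpha\in D^\omega,\qquad [\![G(w)]\!]=\rho_C(w)\ \text{ for all } w\in\operatorname{dom}(G).$$ Here an operator on infinite sequences is computable if a single effective procedure produces, from finite prefixes of the input and consistently under their extension, the letters of the output; the operator is defined exactly at the inputs for which all output letters are produced. -/

import Mathlib

/-! ### Digit spaces and the value of a digit stream -/

/-- The composition `d i₀ ∘ ⋯ ∘ d iₙ₋₁` named by the finite digit sequence `[i₀, …, iₙ₋₁]`. -/
def digitComp {X : Type*} {k : ℕ} (d : Fin k → X → X) : List (Fin k) → X → X
  | [] => id
  | i :: l => d i ∘ digitComp d l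

/-- The prefix `[p 0, …, p (n - 1)]` of an infinite sequence. -/
def streamPrefix {A : Type*} (p : ℕ → A) (n : ℕ) : List A :=
  (List.range n).map p

/-- A digit space: a bounded, complete, nonempty metric space with finitely many contractions
(named by the letters `i : Fin k`) whose ranges cover the space. -/
structure IsDigitSpace {X : Type*} [MetricSpace X] {k : ℕ} (d : Fin k → X → X) : Prop where
  nonempty : Nonempty X
  complete : CompleteSpace X
  bounded : ∃ M : ℝ, ∀ x y : X, dist x y ≤ M
  contraction : ∀ i, ∃ q : ℝ, q < 1 ∧ ∀ x y : X, dist (d i x) (d i y) ≤ q * dist x y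
  cover : (⋃ i, Set.range (d i)) = Set.univ

section Value

variable {X : Type*} [MetricSpace X] {k : ℕ} {d : Fin k → X → X}

theorem IsDigitSpace.exists_common_factor (h : IsDigitSpace d) :
    ∃ q : ℝ, 0 ≤ q ∧ q < 1 ∧ ∀ i, ∀ x y : X, dist (d i x) (d i y) ≤ q * dist x y := by
  choose q hq1 hq using h.contraction
  by_cases hk : Nonempty (Fin k)
  · obtain ⟨j, hj⟩ := Finite.exists_max q
    refine ⟨max (q j) 0, le_max_right _ _, max_lt (hq1 j) one_pos, fun i x y => ?_⟩
    exact (hq i x y).trans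
      (mul_le_mul_of_nonneg_right ((hj i).trans (le_max_left _ _)) dist_nonneg)
  · exact ⟨0, le_rfl, one_pos, fun i => (hk ⟨i⟩).elim⟩

theorem dist_digitComp_le {q : ℝ} (hq0 : 0 ≤ q)
    (hq : ∀ i, ∀ x y : X, dist (d i x) (d i y) ≤ q * dist x y) (l : List (Fin k)) (x y : X) :
    dist (digitComp d l x) (digitComp d l y) ≤ q ^ l.length * dist x y := by
  induction l with
  | nil => simp [digitComp]
  | cons i l ih =>
    calc dist (d i (digitComp d l x)) (d i (digitComp d l y))
        ≤ q * dist (digitComp d l x) (digitComp d l y) := hq i _ _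
      _ ≤ q * (q ^ l.length * dist x y) := mul_le_mul_of_nonneg_left ih hq0
      _ = q ^ (i :: l).length * dist x y := by simp [pow_succ]; ring

theorem digitComp_append {X : Type*} {k : ℕ} {d : Fin k → X → X} (l m : List (Fin k)) (x : X) :
    digitComp d (l ++ m) x = digitComp d l (digitComp d m x) := by
  induction l with
  | nil => rfl
  | cons i l ih => simp [digitComp, ih]

theorem streamPrefix_length {A : Type*} (p : ℕ → A) (n : ℕ) : (streamPrefix p n).length = n := by
  simp [streamPrefix]

theorem streamPrefix_add {A : Type*} (p : ℕ → A) (m n : ℕ) :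
    streamPrefix p (m + n) = streamPrefix p m ++ streamPrefix (fun i => p (m + i)) n := by
  simp [streamPrefix, List.range_add, Function.comp_def]

/-- For a digit stream `α`, the intersection over all `n` of the ranges of the compositions of the
first `n` digits is a singleton. -/
theorem IsDigitSpace.existsUnique_value (h : IsDigitSpace d) (α : ℕ → Fin k) :
    ∃! x : X, x ∈ ⋂ n, Set.range (digitComp d (streamPrefix α n)) := by
  obtain ⟨q, hq0, hq1, hq⟩ := h.exists_common_factor
  obtain ⟨M, hM⟩ := h.bounded
  obtain ⟨x₀⟩ := h.nonempty
  have := h.complete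
  have hcont : ∀ l : List (Fin k), Continuous (digitComp d l) := fun l =>
    (LipschitzWith.of_dist_le_mul (K := ⟨q ^ l.length, by positivity⟩)
      (fun x y => dist_digitComp_le hq0 hq l x y)).continuous
  have hlim : ∀ β : ℕ → Fin k, ∃ y : X,
      Filter.Tendsto (fun n => digitComp d (streamPrefix β n) x₀) Filter.atTop (nhds y) := by
    intro β
    refine cauchySeq_tendsto_of_complete (cauchySeq_of_le_geometric q M hq1 fun n => ?_)
    rw [streamPrefix_add, digitComp_append]
    refine (dist_digitComp_le hq0 hq _ _ _).trans ?_
    rw [streamPrefix_length, mul_comm]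
    exact mul_le_mul_of_nonneg_right (hM _ _) (by positivity)
  obtain ⟨x, hx⟩ := hlim α
  refine ⟨x, Set.mem_iInter.2 fun m => ?_, fun y hy => ?_⟩
  · obtain ⟨z, hz⟩ := hlim (fun i => α (m + i))
    refine ⟨z, tendsto_nhds_unique (((hcont (streamPrefix α m)).tendsto z).comp hz) ?_⟩
    have h2 := (Filter.tendsto_add_atTop_iff_nat m).2 hx
    refine h2.congr fun n => ?_
    simp only [Function.comp]
    rw [add_comm n m, streamPrefix_add, digitComp_append]
  · replace hy := Set.mem_iInter.1 hy
    have h0 : Filter.Tendsto (fun n : ℕ => q ^ n * M) Filter.atTop (nhds 0) := by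
      simpa using (tendsto_pow_atTop_nhds_zero_of_lt_one hq0 hq1).mul_const M
    have h1 : Filter.Tendsto (fun n => dist (digitComp d (streamPrefix α n) x₀) y)
        Filter.atTop (nhds 0) := by
      refine squeeze_zero (fun _ => dist_nonneg) (fun n => ?_) h0
      obtain ⟨z, hz⟩ := hy n
      have h3 := dist_digitComp_le hq0 hq (streamPrefix α n) x₀ z
      rw [hz, streamPrefix_length] at h3
      exact h3.trans (mul_le_mul_of_nonneg_left (hM _ _) (by positivity))
    exact tendsto_nhds_unique (tendsto_iff_dist_tendsto_zero.2 h1) hx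

/-- The value of a digit stream: the unique element of the intersection of the ranges of the
compositions of its finite prefixes. -/
noncomputable def IsDigitSpace.val (h : IsDigitSpace d) (α : ℕ → Fin k) : X :=
  (h.existsUnique_value α).choose

theorem IsDigitSpace.val_mem (h : IsDigitSpace d) (α : ℕ → Fin k) (n : ℕ) :
    h.val α ∈ Set.range (digitComp d (streamPrefix α n)) :=
  Set.mem_iInter.1 (h.existsUnique_value α).choose_spec.1 n

end Value

/-! ### Effectivity. Basic points are given by their indices in a dense sequence `u`. -/

/-- Positive rationals, coded by pairs: `(a, b)` stands for `(a + 1) / (b + 1)`. -/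
def posRat (p : ℕ × ℕ) : ℚ := ((p.1 : ℚ) + 1) / ((p.2 : ℚ) + 1)

/-- Rationals, coded by triples: `(a, b, c)` stands for `(a - b) / (c + 1)`. -/
def codedRat (p : ℕ × ℕ × ℕ) : ℚ := ((p.1 : ℚ) - (p.2.1 : ℚ)) / ((p.2.2 : ℚ) + 1)

/-- The metric space `X` with the dense set of basic points `u 0, u 1, …` is computable: the
relations `dist (u i) (u j) < r` and `dist (u i) (u j) > r` (`r` rational) are both
computably enumerable. -/
structure IsComputableMetric {X : Type*} [MetricSpace X] (u : ℕ → X) : Prop where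
  dense : DenseRange u
  enum_lt : REPred fun p : ℕ × ℕ × (ℕ × ℕ × ℕ) =>
    dist (u p.1) (u p.2.1) < (codedRat p.2.2 : ℝ)
  enum_gt : REPred fun p : ℕ × ℕ × (ℕ × ℕ × ℕ) =>
    dist (u p.1) (u p.2.1) > (codedRat p.2.2 : ℝ)

/-- A map of `X` is computable with respect to the basic points `u`: it has a computable modulus of
uniform continuity, and its values at basic points can be computably approximated by basic
points. -/
def IsComputableMap {X : Type*} [MetricSpace X] (u : ℕ → X) (f : X → X) : Prop :=
  (∃ m : ℕ → ℕ, Computable m ∧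
    ∀ n, ∀ x y : X, dist x y < (1 / 2 : ℝ) ^ m n → dist (f x) (f y) < (1 / 2 : ℝ) ^ n) ∧
  ∃ g : ℕ × ℕ → ℕ, Computable g ∧ ∀ i n, dist (f (u i)) (u (g (i, n))) < (1 / 2 : ℝ) ^ n

/-- A computable digit space `(X, D, Q)` with `Q = {u 0, u 1, …}`. -/
structure IsComputableDigitSpace {X : Type*} [MetricSpace X] {k : ℕ} (d : Fin k → X → X)
    (u : ℕ → X) : Prop extends IsDigitSpace d where
  computableMetric : IsComputableMetric u
  computableDigit : ∀ i, IsComputableMap u (d i)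

/-- Every point lies in the interior of the range of some digit. -/
def IsWellCovering {X : Type*} [MetricSpace X] {k : ℕ} (d : Fin k → X → X) : Prop :=
  ∀ x : X, ∃ i, x ∈ interior (Set.range (d i))

/-- It is decidable whether an open ball with basic centre and positive rational radius is
contained in the range of a given digit. -/
def IsDecidableDigitSpace {X : Type*} [MetricSpace X] {k : ℕ} (d : Fin k → X → X)
    (u : ℕ → X) : Prop :=
  ComputablePred fun p : ℕ × (ℕ × ℕ) × Fin k =>
    Metric.ball (u p.1) (posRat p.2.1 : ℝ) ⊆ Set.range (d p.2.2)

/-- Approximable choice: for every digit `e = d i` there is an effective procedure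
`(θ, w) ↦ v θ w`, defined for positive rational `θ` and basic points `w` in the range of `e` and
with basic values, such that
* `dist (v θ w) (v θ' w) < max θ θ'`;
* from `θ` one can compute `θ' > 0` with `dist (v θ w) (v θ w') < θ` whenever `dist w w' < θ'`;
* some preimage `z` of `w` under `e` satisfies `dist z (v θ w) < θ`. -/
def HasApproximableChoice {X : Type*} [MetricSpace X] {k : ℕ} (d : Fin k → X → X)
    (u : ℕ → X) : Prop :=
  ∀ i, ∃ v : (ℕ × ℕ) × ℕ →. ℕ, Partrec v ∧
    (∀ θ j, u j ∈ Set.range (d i) → (v (θ, j)).Dom) ∧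
    (∀ θ θ' j, u j ∈ Set.range (d i) → ∀ a ∈ v (θ, j), ∀ b ∈ v (θ', j),
      dist (u a) (u b) < max (posRat θ : ℝ) (posRat θ' : ℝ)) ∧
    (∃ m : ℕ × ℕ → ℕ × ℕ, Computable m ∧
      ∀ θ j j', u j ∈ Set.range (d i) → u j' ∈ Set.range (d i) →
        dist (u j) (u j') < (posRat (m θ) : ℝ) →
          ∀ a ∈ v (θ, j), ∀ b ∈ v (θ, j'), dist (u a) (u b) < (posRat θ : ℝ)) ∧
    (∀ θ j, u j ∈ Set.range (d i) → ∀ a ∈ v (θ, j),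
      ∃ z : X, d i z = u j ∧ dist z (u a) < (posRat θ : ℝ))

/-! ### The Cauchy representation and computable operators -/

theorem cauchyName_unique {X : Type*} [MetricSpace X] {u : ℕ → X} {w : ℕ → ℕ} {x y : X}
    (hx : ∀ n, dist x (u (w n)) < (1 / 2 : ℝ) ^ n) (hy : ∀ n, dist y (u (w n)) < (1 / 2 : ℝ) ^ n) :
    x = y := by
  have h0 : Filter.Tendsto (fun n : ℕ => (1 / 2 : ℝ) ^ n) Filter.atTop (nhds 0) :=
    tendsto_pow_atTop_nhds_zero_of_lt_one (by norm_num) (by norm_num)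
  refine tendsto_nhds_unique (f := fun n => u (w n)) (l := Filter.atTop) ?_ ?_
  · refine tendsto_iff_dist_tendsto_zero.2 (squeeze_zero (fun _ => dist_nonneg) (fun n => ?_) h0)
    rw [dist_comm]; exact (hx n).le
  · refine tendsto_iff_dist_tendsto_zero.2 (squeeze_zero (fun _ => dist_nonneg) (fun n => ?_) h0)
    rw [dist_comm]; exact (hy n).le

/-- The Cauchy representation: a sequence `w` of (indices of) basic points represents `x` when
`dist x (u (w n)) < 2⁻ⁿ` for all `n`. -/
noncomputable def cauchyRep {X : Type*} [MetricSpace X] (u : ℕ → X) : (ℕ → ℕ) →. X :=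
  fun w => ⟨∃ x : X, ∀ n, dist x (u (w n)) < (1 / 2 : ℝ) ^ n, fun h => h.choose⟩

theorem mem_cauchyRep {X : Type*} [MetricSpace X] {u : ℕ → X} {w : ℕ → ℕ} {x : X} :
    x ∈ cauchyRep u w ↔ ∀ n, dist x (u (w n)) < (1 / 2 : ℝ) ^ n := by
  constructor
  · rintro ⟨h, rfl⟩
    exact h.choose_spec
  · intro hx
    exact ⟨⟨x, hx⟩, cauchyName_unique (Exists.choose_spec (⟨x, hx⟩ :
      ∃ x : X, ∀ n, dist x (u (w n)) < (1 / 2 : ℝ) ^ n)) hx⟩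

/-- A partial operator on infinite sequences is computable: there is one partial recursive
procedure that, from a finite prefix of the input and a position `n`, may yield the `n`-th
output letter, longer prefixes never contradicting shorter ones. The operator is defined at exactly
those inputs for which every output letter is eventually produced, and its value is the resulting
output sequence. -/
def IsComputableOperator {A B : Type*} [Primcodable A] [Primcodable B]
    (G : (ℕ → A) →. (ℕ → B)) : Prop :=
  ∃ Φ : List A × ℕ →. B, Partrec Φ ∧
    (∀ s t n a b, s <+: t → a ∈ Φ (s, n) → b ∈ Φ (t, n) → a = b) ∧
    ∀ p β, β ∈ G p ↔ ∀ n, ∃ m, β n ∈ Φ (streamPrefix p m, n)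

/-! ### Computability lemmas -/

/-! From streams to names: with a common contraction factor `q < 1`, the value of a stream is fixed
up to `q ^ N * B` by its first `N` digits, where `B` bounds the distances. Replacing every digit map
by its approximation on basic points costs a geometric series of errors (`dist_digitComp_foldr_le`),
so a fold over a prefix of computable length gives the required basic point.

From names to streams: the space is compact, so well-covering has a Lebesgue number. One fixed entry
of a name of `x` therefore determines, by decidability, a digit whose range contains a ball about
`x` of a radius independent of `x` (`exists_digit_selector`). All later entries lie in that range,
and approximable choice turns the name into a name of a preimage of `x` (`exists_preimage_name`).
Iterating yields the digits. The number of rounds is an input, so the recursion runs on codes of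
partial functions of a prefix and an index; these codes are monotone in the prefix
(`remainderCode_mono`), and this makes the output consistent.

This iteration may also succeed on sequences that name no point. Output letter `n` is therefore
withheld until a semidecidable test succeeds on the pair of entries coded by `n`; all tests succeed
exactly on Cauchy names (`confirms_eventually`, `exists_limit_of_confirms`). -/

theorem primrec_two_pow : Primrec fun n : ℕ => 2 ^ n :=
  (Primrec.nat_rec₁ (f := fun _ a => 2 * a) 1
    (Primrec.nat_mul.comp (Primrec.const 2) Primrec.snd).to₂).of_eq fun n => by
      induction n with
      | zero => rfl
      | succ n ih => simp only [ih, pow_succ]; ring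

/-- A right fold is a left fold over the reversed list, and that is a recursion on the index into
it. -/
theorem Computable.list_foldr {α β σ : Type*} [Primcodable α] [Primcodable β] [Primcodable σ]
    {f : α → List β} {b : α → σ} {g : α → β × σ → σ} (hf : Computable f) (hb : Computable b)
    (hg : Computable₂ g) : Computable fun a => (f a).foldr (fun x y => g a (x, y)) (b a) := by
  have hstep : Computable₂ fun (a : α) (p : ℕ × σ) =>
      Option.casesOn (motive := fun _ => σ) ((f a).reverse[p.1]?) p.2 fun x => g a (x, p.2) :=
    (Computable.option_casesOn
      (Computable.list_getElem?.comp (Computable.list_reverse.comp (hf.comp Computable.fst))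
        (Computable.fst.comp Computable.snd))
      (Computable.snd.comp Computable.snd)
      (hg.comp (Computable.fst.comp Computable.fst)
        (Computable.snd.pair (Computable.snd.comp (Computable.snd.comp Computable.fst)))).to₂).to₂
  refine (Computable.nat_rec (Computable.list_length.comp hf) hb hstep).of_eq fun a => ?_
  generalize f a = l
  suffices H : ∀ r : List β, ∀ n ≤ r.length,
      Nat.rec (motive := fun _ => σ) (b a) (fun n y =>
        Option.casesOn (motive := fun _ => σ) (r[n]?) y fun x => g a (x, y)) n =
      (r.take n).foldl (fun y x => g a (x, y)) (b a) by
    rw [H l.reverse l.length (by simp), List.take_of_length_le (by simp), List.foldl_reverse]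
  intro r n hn
  induction n with
  | zero => simp
  | succ n ih =>
    simp only [ih (by omega)]
    rw [List.getElem?_eq_getElem (by omega), List.take_succ_eq_append_getElem (by omega), List.foldl_append]
    rfl

theorem REPred.comp {α β : Type*} [Primcodable α] [Primcodable β] {p : β → Prop} {f : α → β}
    (hp : REPred p) (hf : Computable f) : REPred fun a => p (f a) :=
  Partrec.comp hp hf

theorem REPred.and {α : Type*} [Primcodable α] {p q : α → Prop} (hp : REPred p) (hq : REPred q) :
    REPred fun a => p a ∧ q a :=
  (Partrec.bind hp (Partrec.comp hq Computable.fst).to₂).of_eq fun a => Part.ext fun b => by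
    simp

/-- Search the finite list of candidates in order; an arbitrary value is returned if all fail. -/
theorem ComputablePred.exists_choice {α : Type*} [Primcodable α] {k : ℕ} [Nonempty (Fin k)]
    {p : α × Fin k → Prop} (hp : ComputablePred p) :
    ∃ δ : α → Fin k, Computable δ ∧ ∀ a i, p (a, i) → p (a, δ a) := by
  obtain ⟨f, hf, rfl⟩ := ComputablePred.computable_iff.1 hp
  suffices H : ∀ l : List (Fin k), ∃ δ : α → Fin k, Computable δ ∧
      ∀ a, ∀ i ∈ l, f (a, i) = true → f (a, δ a) = true by
    obtain ⟨δ, hδ, h⟩ := H (List.finRange k)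
    exact ⟨δ, hδ, fun a i => h a i (List.mem_finRange i)⟩
  intro l
  induction l with
  | nil => exact ⟨fun _ => Classical.arbitrary _, Computable.const _, by simp⟩
  | cons i l ih =>
    obtain ⟨δ, hδ, h⟩ := ih
    refine ⟨fun a => bif f (a, i) then i else δ a, Computable.cond
      (hf.comp (Computable.id.pair (Computable.const i))) (Computable.const i) hδ, ?_⟩
    intro a j hj hfj
    cases hi : f (a, i) with
    | true => simp only [hi, cond_true]
    | false =>
      rcases List.mem_cons.1 hj with rfl | hj
      · simp [hi] at hfj
      · simpa only [hi, cond_false] using h a j hj hfj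

/-! ### Codes for iterated refinement of names -/

open Nat.Partrec in
theorem Partrec.exists_code {α β : Type*} [Primcodable α] [Primcodable β] {f : α →. β}
    (hf : Partrec f) : ∃ c : Code, ∀ a, c.eval (Encodable.encode a) = (f a).map Encodable.encode := by
  obtain ⟨c, hc⟩ := Code.exists_code.1 hf
  exact ⟨c, fun a => by simp [hc]⟩

/-- The code of the partial function `(s, n) ↦ v (n, c (s, m n))`. -/
def refineCode (v m c : Nat.Partrec.Code) : Nat.Partrec.Code :=
  .comp v (.pair .right (.comp c (.pair .left (.comp m .right))))

theorem eval_refineCode (v m c : Nat.Partrec.Code) (s n : ℕ) :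
    (refineCode v m c).eval (Nat.pair s n) =
      (m.eval n).bind fun i => (c.eval (Nat.pair s i)).bind fun a => v.eval (Nat.pair n a) := by
  simp only [refineCode, Nat.Partrec.Code.eval, Seq.seq, Part.map_eq_map, PFun.coe_val,
    Nat.unpair_pair, Part.map_some, Part.bind_some]
  change (((((Part.some n).bind fun i => m.eval i).map (Nat.pair s)).bind fun i =>
    c.eval i).map (Nat.pair n)).bind (fun i => v.eval i) = _
  rw [Part.bind_some, Part.bind_map, Part.bind_map, Part.bind_assoc]

theorem primrec_refineCode {α : Type*} [Primcodable α] {v m c : α → Nat.Partrec.Code}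
    (hv : Primrec v) (hm : Primrec m) (hc : Primrec c) :
    Primrec fun a => refineCode (v a) (m a) (c a) := by
  unfold refineCode
  exact Nat.Partrec.Code.primrec₂_comp.comp hv
    (Nat.Partrec.Code.primrec₂_pair.comp (Primrec.const _)
      (Nat.Partrec.Code.primrec₂_comp.comp hc
        (Nat.Partrec.Code.primrec₂_pair.comp (Primrec.const _)
          (Nat.Partrec.Code.primrec₂_comp.comp hm (Primrec.const _)))))

/-- The code of the name of the `j`-th remainder: starting from `c`, each round reads the `n₀`-th
entry of the current name of the remainder off the prefix `s`, and refines the name by the digit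
which `δ` selects from that entry. -/
def remainderCode {k : ℕ} (V M : Fin k → Nat.Partrec.Code) (δ : ℕ → Fin k) (n₀ : ℕ)
    (c : Nat.Partrec.Code) (s : List ℕ) (j : ℕ) : Part Nat.Partrec.Code :=
  Nat.rec (Part.some c) (fun _ IH => IH.bind fun c =>
    (c.eval (Nat.pair (Encodable.encode s) n₀)).bind fun a =>
      Part.some (refineCode (V (δ a)) (M (δ a)) c)) j

/-- The digit selected in the `j`-th round. -/
def remainderDigit {k : ℕ} (V M : Fin k → Nat.Partrec.Code) (δ : ℕ → Fin k) (n₀ : ℕ)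
    (c : Nat.Partrec.Code) (s : List ℕ) (j : ℕ) : Part (Fin k) :=
  (remainderCode V M δ n₀ c s j).bind fun c =>
    (c.eval (Nat.pair (Encodable.encode s) n₀)).bind fun a => Part.some (δ a)

section

variable {k : ℕ} {V M : Fin k → Nat.Partrec.Code} {δ : ℕ → Fin k} {n₀ : ℕ} {c : Nat.Partrec.Code}

/-- Each round evaluates the current code by the universal function and then builds a new code
primitively recursively; `V` and `M` are finite tables. -/
theorem partrec_remainderCode (hδ : Computable δ) :
    Partrec fun p : List ℕ × ℕ => remainderCode V M δ n₀ c p.1 p.2 := by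
  refine Partrec.nat_rec (h := fun (p : List ℕ × ℕ) (q : ℕ × Nat.Partrec.Code) =>
    (q.2.eval (Nat.pair (Encodable.encode p.1) n₀)).bind fun a =>
      Part.some (refineCode (V (δ a)) (M (δ a)) q.2)) Computable.snd (Computable.const c) ?_
  have he : Partrec fun x : (List ℕ × ℕ) × (ℕ × Nat.Partrec.Code) =>
      x.2.2.eval (Nat.pair (Encodable.encode x.1.1) n₀) :=
    Nat.Partrec.Code.eval_part.comp (Computable.snd.comp Computable.snd)
      (Primrec₂.natPair.to_comp.comp
        (Computable.encode.comp (Computable.fst.comp Computable.fst)) (Computable.const n₀))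
  have h : Primrec fun q : Fin k × Nat.Partrec.Code => refineCode (V q.1) (M q.1) q.2 :=
    primrec_refineCode ((Primrec.dom_finite V).comp .fst) ((Primrec.dom_finite M).comp .fst) .snd
  have h' : Computable₂ fun (x : (List ℕ × ℕ) × (ℕ × Nat.Partrec.Code)) (a : ℕ) =>
      refineCode (V (δ a)) (M (δ a)) x.2.2 :=
    h.to_comp.comp ((hδ.comp Computable.snd).pair
      (Computable.snd.comp (Computable.snd.comp Computable.fst)))
  exact he.bind h'.partrec₂

theorem partrec_remainderDigit (hδ : Computable δ) :
    Partrec fun p : List ℕ × ℕ => remainderDigit V M δ n₀ c p.1 p.2 := by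
  have he : Partrec fun x : (List ℕ × ℕ) × Nat.Partrec.Code =>
      x.2.eval (Nat.pair (Encodable.encode x.1.1) n₀) :=
    Nat.Partrec.Code.eval_part.comp Computable.snd (Primrec₂.natPair.to_comp.comp
      (Computable.encode.comp (Computable.fst.comp Computable.fst)) (Computable.const n₀))
  have hs : Partrec₂ fun (_ : (List ℕ × ℕ) × Nat.Partrec.Code) (a : ℕ) => Part.some (δ a) :=
    (hδ.comp Computable.snd).partrec
  exact (partrec_remainderCode hδ).bind (he.bind hs).to₂

/-- The values of the partial function with code `c` persist when the prefix is extended. -/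
def IsMonotoneCode (c : Nat.Partrec.Code) : Prop :=
  ∀ ⦃s t : List ℕ⦄, s <+: t → ∀ n, ∀ a ∈ c.eval (Nat.pair (Encodable.encode s) n),
    a ∈ c.eval (Nat.pair (Encodable.encode t) n)

theorem IsMonotoneCode.refineCode {v m c : Nat.Partrec.Code} (hc : IsMonotoneCode c) :
    IsMonotoneCode (refineCode v m c) := by
  intro s t hst n a
  simp only [eval_refineCode, Part.mem_bind_iff]
  rintro ⟨i, hi, b, hb, ha⟩
  exact ⟨i, hi, b, hc hst i b hb, ha⟩

theorem isMonotoneCode_of_mem_remainderCode (hc : IsMonotoneCode c) {s : List ℕ} (j : ℕ) :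
    ∀ c' ∈ remainderCode V M δ n₀ c s j, IsMonotoneCode c' := by
  induction j with
  | zero => intro c' h; rw [Part.mem_some_iff.1 h]; exact hc
  | succ j ih =>
    intro c' h
    obtain ⟨c₁, h₁, h⟩ := Part.mem_bind_iff.1 h
    obtain ⟨a, -, h⟩ := Part.mem_bind_iff.1 h
    rw [Part.mem_some_iff.1 h]
    exact (ih _ h₁).refineCode

/-- Every round reads one value of a monotone code. That value survives extension, so the same digit
is selected and the very same code results. -/
theorem remainderCode_mono (hc : IsMonotoneCode c) {s t : List ℕ} (hst : s <+: t) (j : ℕ) :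
    ∀ c' ∈ remainderCode V M δ n₀ c s j, c' ∈ remainderCode V M δ n₀ c t j := by
  induction j with
  | zero => intro c' h; exact h
  | succ j ih =>
    intro c' h
    obtain ⟨c₁, h₁, h⟩ := Part.mem_bind_iff.1 h
    obtain ⟨a, ha, h⟩ := Part.mem_bind_iff.1 h
    exact Part.mem_bind_iff.2 ⟨c₁, ih _ h₁, Part.mem_bind_iff.2
      ⟨a, isMonotoneCode_of_mem_remainderCode hc j _ h₁ hst _ _ ha, h⟩⟩

theorem remainderDigit_mono (hc : IsMonotoneCode c) {s t : List ℕ} (hst : s <+: t) (j : ℕ) :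
    ∀ i ∈ remainderDigit V M δ n₀ c s j, i ∈ remainderDigit V M δ n₀ c t j := by
  intro i h
  obtain ⟨c₁, h₁, h⟩ := Part.mem_bind_iff.1 h
  obtain ⟨a, ha, h⟩ := Part.mem_bind_iff.1 h
  exact Part.mem_bind_iff.2 ⟨c₁, remainderCode_mono hc hst j _ h₁, Part.mem_bind_iff.2
    ⟨a, isMonotoneCode_of_mem_remainderCode hc j _ h₁ hst _ _ ha, h⟩⟩

end

/-! ### Prefixes, operators given by procedures, finite families -/

theorem streamPrefix_prefix {A : Type*} (p : ℕ → A) {m n : ℕ} (h : m ≤ n) :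
    streamPrefix p m <+: streamPrefix p n := by
  obtain ⟨r, rfl⟩ := Nat.exists_eq_add_of_le h
  rw [streamPrefix_add]
  exact List.prefix_append _ _

theorem streamPrefix_succ {A : Type*} (p : ℕ → A) (n : ℕ) :
    streamPrefix p (n + 1) = streamPrefix p n ++ [p n] := by
  simp [streamPrefix, List.range_succ]

theorem streamPrefix_getElem? {A : Type*} (p : ℕ → A) {i n : ℕ} (h : i < n) :
    (streamPrefix p n)[i]? = some (p i) := by
  simp [streamPrefix, h]

/-- A computable operator is given by its procedure, provided the values of the procedure do not
contradict each other. -/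
theorem isComputableOperator_mk {A B : Type*} [Primcodable A] [Primcodable B]
    {Φ : List A × ℕ →. B} (hΦ : Partrec Φ)
    (hcons : ∀ s t n a b, s <+: t → a ∈ Φ (s, n) → b ∈ Φ (t, n) → a = b) :
    ∃ G : (ℕ → A) →. (ℕ → B), IsComputableOperator G ∧
      ∀ p β, β ∈ G p ↔ ∀ n, ∃ m, β n ∈ Φ (streamPrefix p m, n) := by
  have key : ∀ (p : ℕ → A) (β β' : ℕ → B), (∀ n, ∃ m, β n ∈ Φ (streamPrefix p m, n)) →
      (∀ n, ∃ m, β' n ∈ Φ (streamPrefix p m, n)) → β = β' := by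
    intro p β β' h h'
    funext n
    obtain ⟨m, hm⟩ := h n
    obtain ⟨m', hm'⟩ := h' n
    rcases le_total m m' with hle | hle
    · exact hcons _ _ _ _ _ (streamPrefix_prefix p hle) hm hm'
    · exact (hcons _ _ _ _ _ (streamPrefix_prefix p hle) hm' hm).symm
  have hG : ∀ (p : ℕ → A) (β : ℕ → B), β ∈ (⟨∃ β : ℕ → B, ∀ n, ∃ m, β n ∈ Φ (streamPrefix p m, n),
      fun h => h.choose⟩ : Part (ℕ → B)) ↔ ∀ n, ∃ m, β n ∈ Φ (streamPrefix p m, n) := by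
    intro p β
    constructor
    · rintro ⟨h, rfl⟩
      exact h.choose_spec
    · intro h
      exact ⟨⟨β, h⟩, key p _ _ (Exists.choose_spec (⟨β, h⟩ :
        ∃ β : ℕ → B, ∀ n, ∃ m, β n ∈ Φ (streamPrefix p m, n))) h⟩
  exact ⟨_, ⟨Φ, hΦ, hcons, hG⟩, hG⟩

/-- Choose a code for each index: a finite table of codes is computable, and universal evaluation
does the rest. -/
theorem Partrec.of_finite_family {ι α σ : Type*} [Primcodable ι] [Finite ι] [Primcodable α]
    [Primcodable σ] {f : ι → α →. σ} (hf : ∀ i, Partrec (f i)) :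
    Partrec fun p : ι × α => f p.1 p.2 := by
  choose c hc using fun i => (hf i).exists_code
  have he : Partrec fun p : ι × α => (c p.1).eval (Encodable.encode p.2) :=
    Nat.Partrec.Code.eval_part.comp ((Primrec.dom_finite c).to_comp.comp Computable.fst)
      (Computable.encode.comp Computable.snd)
  have hd : Partrec₂ fun (_ : ι × α) (n : ℕ) => (Encodable.decode (α := σ) n : Part σ) :=
    (Computable.decode.comp Computable.snd).ofOption
  refine (he.bind hd).of_eq fun p => ?_
  simp [hc, Part.bind_map]

theorem Computable.of_finite_family {ι α σ : Type*} [Primcodable ι] [Finite ι] [Primcodable α]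
    [Primcodable σ] {f : ι → α → σ} (hf : ∀ i, Computable (f i)) :
    Computable fun p : ι × α => f p.1 p.2 :=
  Partrec.of_finite_family (f := fun i => (f i : α →. σ)) hf

/-! ### Evaluation of digit streams -/

section Topology

variable {X : Type*} [MetricSpace X] {k : ℕ} {d : Fin k → X → X} {u : ℕ → X}

theorem IsDigitSpace.nonempty_digit (h : IsDigitSpace d) : Nonempty (Fin k) := by
  obtain ⟨x⟩ := h.nonempty
  have hx : x ∈ ⋃ i, Set.range (d i) := h.cover ▸ Set.mem_univ x
  obtain ⟨i, -⟩ := Set.mem_iUnion.1 hx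
  exact ⟨i⟩

theorem IsDigitSpace.eq_val (h : IsDigitSpace d) {α : ℕ → Fin k} {x : X}
    (hx : ∀ n, x ∈ Set.range (digitComp d (streamPrefix α n))) : h.val α = x :=
  (h.existsUnique_value α).unique (h.existsUnique_value α).choose_spec.1 (Set.mem_iInter.2 hx)

theorem IsDigitSpace.exists_digitComp_eq (h : IsDigitSpace d) (n : ℕ) (x : X) :
    ∃ l : List (Fin k), l.length = n ∧ ∃ y, digitComp d l y = x := by
  induction n generalizing x with
  | zero => exact ⟨[], rfl, x, rfl⟩
  | succ n ih =>
    have hx : x ∈ ⋃ i, Set.range (d i) := h.cover ▸ Set.mem_univ x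
    obtain ⟨i, z, rfl⟩ := Set.mem_iUnion.1 hx
    obtain ⟨l, hl, y, rfl⟩ := ih z
    exact ⟨i :: l, by simp [hl], y, rfl⟩

/-- The ranges of the words of length `n` cover the space and have diameter at most `q ^ n * B`; one
point from each is a finite net. -/
theorem IsDigitSpace.compactSpace (h : IsDigitSpace d) : CompactSpace X := by
  have := h.complete
  obtain ⟨q, hq0, hq1, hq⟩ := h.exists_common_factor
  obtain ⟨B, hB⟩ := h.bounded
  obtain ⟨x₀⟩ := h.nonempty
  refine ⟨isCompact_iff_totallyBounded_isComplete.2 ⟨Metric.totallyBounded_iff.2 fun ε hε => ?_,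
    isComplete_univ⟩⟩
  have h0 : Filter.Tendsto (fun n : ℕ => q ^ n * B) Filter.atTop (nhds 0) := by
    simpa using (tendsto_pow_atTop_nhds_zero_of_lt_one hq0 hq1).mul_const B
  obtain ⟨n, hn⟩ := (h0.eventually_lt_const hε).exists
  refine ⟨_, (List.finite_length_eq (Fin k) n).image fun l => digitComp d l x₀, fun x _ => ?_⟩
  obtain ⟨l, hl, y, rfl⟩ := h.exists_digitComp_eq n x
  refine Set.mem_iUnion₂.2 ⟨_, Set.mem_image_of_mem _ hl, ?_⟩
  calc dist (digitComp d l y) (digitComp d l x₀)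
      ≤ q ^ l.length * dist y x₀ := dist_digitComp_le hq0 hq l y x₀
    _ ≤ q ^ n * B := by
        rw [show l.length = n from hl]; exact mul_le_mul_of_nonneg_left (hB _ _) (by positivity)
    _ < ε := hn

/-- An error `t` becomes at most `q * t + e` under one more approximated digit, and `e / (1 - q)` is
the fixed point of this map. The start index `0` is arbitrary, since its error is at most `B`. -/
theorem dist_digitComp_foldr_le {q B e : ℝ} (hq0 : 0 ≤ q) (hq1 : q < 1)
    (hq : ∀ i, ∀ x y : X, dist (d i x) (d i y) ≤ q * dist x y) (hB : ∀ x y : X, dist x y ≤ B)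
    {g : Fin k → ℕ → ℕ} (hg : ∀ i a, dist (d i (u a)) (u (g i a)) ≤ e) (l : List (Fin k)) (z : X)
    (he : 0 ≤ e) :
    dist (digitComp d l z) (u (l.foldr g 0)) ≤ q ^ l.length * B + e / (1 - q) := by
  induction l with
  | nil =>
    have : 0 ≤ e / (1 - q) := div_nonneg he (by linarith)
    simpa [digitComp] using (hB z (u 0)).trans (by linarith)
  | cons i l ih =>
    have h1 : q * (e / (1 - q)) + e = e / (1 - q) := by
      field_simp [show (1 - q) ≠ 0 by linarith]; ring
    calc dist (d i (digitComp d l z)) (u (g i (l.foldr g 0)))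
        ≤ dist (d i (digitComp d l z)) (d i (u (l.foldr g 0)))
          + dist (d i (u (l.foldr g 0))) (u (g i (l.foldr g 0))) := dist_triangle _ _ _
      _ ≤ q * (q ^ l.length * B + e / (1 - q)) + e :=
          add_le_add ((hq i _ _).trans (mul_le_mul_of_nonneg_left ih hq0)) (hg _ _)
      _ = q ^ (i :: l).length * B + e / (1 - q) := by
          rw [mul_add, add_assoc, h1, List.length_cons, pow_succ]; ring

theorem IsComputableDigitSpace.exists_evaluation (hX : IsComputableDigitSpace d u) :
    ∃ F : (ℕ → Fin k) → (ℕ → ℕ), IsComputableOperator (fun α => Part.some (F α)) ∧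
      ∀ α n, dist (hX.toIsDigitSpace.val α) (u (F α n)) < (1 / 2 : ℝ) ^ n := by
  obtain ⟨q, hq0, hq1, hq⟩ := hX.exists_common_factor
  obtain ⟨B, hB⟩ := hX.bounded
  choose g hgc hg using fun i => (hX.computableDigit i).2
  -- `K` digits at least halve distances, `C` extra halvings absorb the diameter bound, and `C'`
  -- extra bits of precision absorb the factor `1 / (1 - q)`. Truncation and approximation then each
  -- contribute at most half of `2⁻ⁿ`.
  obtain ⟨K, hK⟩ := exists_pow_lt_of_lt_one (show (0 : ℝ) < 1 / 2 by norm_num) hq1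
  obtain ⟨C, hC⟩ := pow_unbounded_of_one_lt B (show (1 : ℝ) < 2 by norm_num)
  obtain ⟨C', hC'⟩ := exists_pow_lt_of_lt_one (sub_pos.2 hq1) (show (1 / 2 : ℝ) < 1 by norm_num)
  have hB0 : 0 ≤ B := by
    obtain ⟨x⟩ := hX.nonempty
    exact dist_nonneg.trans (hB x x)
  let N : ℕ → ℕ := fun n => K * (n + 1 + C)
  let val : List (Fin k) → ℕ → ℕ := fun l n => l.foldr (fun i a => g i (a, n + 1 + C')) 0
  have hN : Computable N :=
    (Primrec.nat_mul.comp (Primrec.const K) (Primrec.nat_add.comp Primrec.succ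
      (Primrec.const C))).to_comp
  have hp : Computable fun n : ℕ => n + 1 + C' :=
    (Primrec.nat_add.comp Primrec.succ (Primrec.const C')).to_comp
  have hval : Computable₂ val := by
    have hgg : Computable₂ fun (p : List (Fin k) × ℕ) (r : Fin k × ℕ) =>
        g r.1 (r.2, p.2 + 1 + C') :=
      (Computable.of_finite_family hgc).comp ((Computable.fst.comp Computable.snd).pair
        ((Computable.snd.comp Computable.snd).pair
          (hp.comp (Computable.snd.comp Computable.fst))))
    exact Computable.list_foldr Computable.fst (Computable.const 0) hgg
  -- The procedure waits for `N n` digits and truncates to exactly that many, so longer prefixes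
  -- give the same answer.
  refine ⟨fun α n => val (streamPrefix α (N n)) n,
    ⟨fun p => (bif decide (N p.2 ≤ p.1.length) then some (val (p.1.take (N p.2)) p.2) else none :
      Option ℕ), ?_, ?_, ?_⟩, ?_⟩
  · refine Computable.ofOption (Computable.cond ?_ (Computable.option_some.comp
      (hval.comp (Primrec.list_take.to_comp.comp (hN.comp Computable.snd) Computable.fst)
        Computable.snd)) (Computable.const none))
    exact Primrec.nat_le.decide.to_comp.comp (hN.comp Computable.snd)
      (Computable.list_length.comp Computable.fst)
  · rintro s t n a b ⟨r, rfl⟩ ha hb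
    simp only [Part.mem_ofOption, Option.mem_def, Bool.cond_decide, ite_eq_iff, Option.some.injEq,
      reduceCtorEq, and_false, or_false] at ha hb
    rw [← ha.2, ← hb.2, List.take_append_of_le_length ha.1]
  · intro α β
    have htake : ∀ n m, N n ≤ m → (streamPrefix α m).take (N n) = streamPrefix α (N n) := by
      intro n m h
      have := List.prefix_iff_eq_take.1 (streamPrefix_prefix α h)
      rwa [streamPrefix_length, eq_comm] at this
    simp only [Part.mem_some_iff, Part.mem_ofOption, Option.mem_def, Bool.cond_decide, ite_eq_iff,
      Option.some.injEq, reduceCtorEq, and_false, or_false, streamPrefix_length]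
    constructor
    · rintro rfl n
      exact ⟨N n, le_rfl, by rw [htake _ _ le_rfl]⟩
    · intro h
      funext n
      obtain ⟨m, hm, h⟩ := h n
      rw [← h, htake _ _ hm]
  · intro α n
    obtain ⟨z, hz⟩ := hX.toIsDigitSpace.val_mem α (N n)
    have h1 := dist_digitComp_foldr_le hq0 hq1 hq hB (u := u) (e := (1 / 2) ^ (n + 1 + C'))
      (fun i a => (hg i a (n + 1 + C')).le) (streamPrefix α (N n)) z (by positivity)
    rw [hz, streamPrefix_length] at h1
    have h2 : q ^ N n * B ≤ (1 / 2) ^ (n + 1) := by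
      calc q ^ N n * B = (q ^ K) ^ (n + 1 + C) * B := by rw [← pow_mul]
        _ ≤ (1 / 2) ^ (n + 1 + C) * 2 ^ C :=
            mul_le_mul (pow_le_pow_left₀ (by positivity) hK.le _) hC.le hB0 (by positivity)
        _ = (1 / 2) ^ (n + 1) := by rw [pow_add _ (n + 1), mul_assoc, ← mul_pow]; norm_num
    have h3 : (1 / 2 : ℝ) ^ (n + 1 + C') / (1 - q) < (1 / 2) ^ (n + 1) := by
      rw [div_lt_iff₀ (sub_pos.2 hq1), pow_add _ (n + 1)]
      exact mul_lt_mul_of_pos_left hC' (by positivity)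
    calc _ ≤ _ := h1
      _ < (1 / 2 : ℝ) ^ (n + 1) + (1 / 2) ^ (n + 1) := add_lt_add_of_le_of_lt h2 h3
      _ = (1 / 2) ^ n := by ring

end Topology

/-! ### From Cauchy names to digit streams -/

/-- A code of the positive rational `2⁻ⁿ`. -/
def halfPow (n : ℕ) : ℕ × ℕ := (0, 2 ^ n - 1)

theorem posRat_halfPow (n : ℕ) : (posRat (halfPow n) : ℝ) = (1 / 2) ^ n := by
  simp [posRat, halfPow]

theorem primrec_halfPow : Primrec halfPow :=
  (Primrec.const 0).pair (Primrec.nat_sub.comp primrec_two_pow (Primrec.const 1))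

/-- Two entries of a name from index `p.2 + 1` on are thus closer than `posRat p`: the denominator
alone yields a computable index. -/
theorem two_mul_half_pow_le_posRat (p : ℕ × ℕ) : 2 * (1 / 2 : ℝ) ^ (p.2 + 1) ≤ posRat p := by
  have h1 : ((p.2 : ℝ) + 1) ≤ 2 ^ p.2 := by exact_mod_cast Nat.lt_two_pow_self (n := p.2)
  calc 2 * (1 / 2 : ℝ) ^ (p.2 + 1) = 1 / 2 ^ p.2 := by rw [pow_succ, one_div_pow]; ring
    _ ≤ 1 / ((p.2 : ℝ) + 1) := one_div_le_one_div_of_le (by positivity) h1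
    _ ≤ ((p.1 : ℝ) + 1) / ((p.2 : ℝ) + 1) := by gcongr; simp
    _ = posRat p := by simp [posRat]

theorem half_pow_le_half_pow {m n : ℕ} (h : m ≤ n) : (1 / 2 : ℝ) ^ n ≤ (1 / 2) ^ m :=
  pow_le_pow_of_le_one (by norm_num) (by norm_num) h

/-- The last entry of the prefix `s` of length `m + 1` guarantees that every point within `2⁻ᵐ` of
this entry is within `2⁻ⁱ` of the `i`-th entry. -/
def Confirms {X : Type*} [MetricSpace X] (u : ℕ → X) (s : List ℕ) (i : ℕ) : Prop :=
  dist (u (s.getD (s.length - 1) 0)) (u (s.getD i 0)) < (1 / 2) ^ i - (1 / 2) ^ (s.length - 1)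

/-! ### Recognising Cauchy names; selecting digits and refining names -/

section

variable {X : Type*} [MetricSpace X] {k : ℕ} {d : Fin k → X → X} {u : ℕ → X}

theorem IsComputableMetric.rePred_confirms (hu : IsComputableMetric u) :
    REPred fun p : List ℕ × ℕ => Confirms u p.1 p.2 := by
  have hlast : Primrec fun p : List ℕ × ℕ => p.1.length - 1 :=
    Primrec.nat_sub.comp (Primrec.list_length.comp .fst) (Primrec.const 1)
  -- With `L` the last index, the triple codes `(2^L - 2^i) / 2^(i+L) = 2⁻ⁱ - 2⁻ᴸ`.
  have h : Primrec fun p : List ℕ × ℕ => (p.1.getD (p.1.length - 1) 0, p.1.getD p.2 0,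
      2 ^ (p.1.length - 1), 2 ^ p.2, 2 ^ (p.2 + (p.1.length - 1)) - 1) :=
    ((Primrec.list_getD 0).comp .fst hlast).pair (((Primrec.list_getD 0).comp .fst .snd).pair
      ((primrec_two_pow.comp hlast).pair ((primrec_two_pow.comp .snd).pair
        (Primrec.nat_sub.comp (primrec_two_pow.comp (Primrec.nat_add.comp .snd hlast))
          (Primrec.const 1)))))
  refine (hu.enum_lt.comp h.to_comp).of_eq fun p => ?_
  have hr : (codedRat (2 ^ (p.1.length - 1), 2 ^ p.2, 2 ^ (p.2 + (p.1.length - 1)) - 1) : ℝ) =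
      (1 / 2) ^ p.2 - (1 / 2) ^ (p.1.length - 1) := by
    simp [codedRat, pow_add]
    field_simp
  rw [Confirms, ← hr]

/-- If the prefix is empty or too short to contain entry `i`, the bound is not positive and the test
fails, so the default values are harmless. -/
theorem confirms_streamPrefix {w : ℕ → ℕ} {m i : ℕ} : Confirms u (streamPrefix w m) i ↔
    ∃ r, m = r + 1 ∧ dist (u (w r)) (u (w i)) < (1 / 2) ^ i - (1 / 2) ^ r := by
  unfold Confirms
  rw [streamPrefix_length]
  rcases m with _ | r
  · simp only [Nat.zero_sub, pow_zero]
    refine iff_of_false (fun h => ?_) (by simp)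
    linarith [dist_nonneg.trans_lt h, half_pow_le_half_pow (Nat.zero_le i), pow_zero (1 / 2 : ℝ)]
  · simp only [Nat.add_sub_cancel, Nat.add_right_cancel_iff, exists_eq_left']
    rcases Nat.lt_or_ge r i with hri | hir
    · refine iff_of_false (fun h => ?_) (fun h => ?_) <;>
        linarith [dist_nonneg.trans_lt h, half_pow_le_half_pow hri.le]
    · rw [List.getD_eq_getElem?_getD, List.getD_eq_getElem?_getD,
        streamPrefix_getElem? w (Nat.lt_succ_self r), streamPrefix_getElem? w (by omega)]
      rfl

/-- The strict inequality at `i` leaves slack, which eventually exceeds `2 * 2⁻ʳ`. -/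
theorem confirms_eventually {w : ℕ → ℕ} {x : X} (hx : ∀ n, dist x (u (w n)) < (1 / 2) ^ n)
    (i : ℕ) : ∀ᶠ m in Filter.atTop, Confirms u (streamPrefix w m) i := by
  have h0 : Filter.Tendsto (fun n : ℕ => 2 * (1 / 2 : ℝ) ^ n) Filter.atTop (nhds 0) := by
    simpa using (tendsto_pow_atTop_nhds_zero_of_lt_one (r := (1 / 2 : ℝ))
      (by norm_num) (by norm_num)).const_mul 2
  have h1 := h0.eventually_lt_const (sub_pos.2 (hx i))
  obtain ⟨r₀, hr₀⟩ := Filter.eventually_atTop.1 h1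
  refine Filter.eventually_atTop.2 ⟨r₀ + 1, fun m hm => ?_⟩
  obtain ⟨r, rfl⟩ : ∃ r, m = r + 1 := ⟨m - 1, by omega⟩
  refine confirms_streamPrefix.2 ⟨r, rfl, ?_⟩
  linarith [hr₀ r (by omega), hx r, dist_triangle_left (u (w r)) (u (w i)) x]

/-- Two entries confirmed by the same prefix are close to its last entry and hence to each other, so
the sequence is Cauchy. The limit satisfies the bounds weakly; one more use of a confirmation makes
them strict. -/
theorem exists_limit_of_confirms [CompleteSpace X] {w : ℕ → ℕ}
    (h : ∀ i j, ∃ m, Confirms u (streamPrefix w m) i ∧ Confirms u (streamPrefix w m) j) :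
    ∃ x, ∀ n, dist x (u (w n)) < (1 / 2) ^ n := by
  have hd : ∀ i j, dist (u (w i)) (u (w j)) < (1 / 2) ^ i + (1 / 2) ^ j := by
    intro i j
    obtain ⟨m, hi, hj⟩ := h i j
    obtain ⟨r, rfl, hi⟩ := confirms_streamPrefix.1 hi
    obtain ⟨r', hr, hj⟩ := confirms_streamPrefix.1 hj
    obtain rfl : r = r' := by omega
    have : (0 : ℝ) < (1 / 2) ^ r := by positivity
    linarith [dist_triangle_left (u (w i)) (u (w j)) (u (w r))]
  have h0 : Filter.Tendsto (fun n : ℕ => (1 / 2 : ℝ) ^ n) Filter.atTop (nhds 0) :=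
    tendsto_pow_atTop_nhds_zero_of_lt_one (by norm_num) (by norm_num)
  have hc : CauchySeq fun n => u (w n) := by
    refine cauchySeq_of_le_tendsto_0 (fun n => (1 / 2) ^ n + (1 / 2) ^ n) (fun n m N hn hm => ?_)
      (by simpa using h0.add h0)
    exact (hd n m).le.trans (add_le_add (half_pow_le_half_pow hn) (half_pow_le_half_pow hm))
  obtain ⟨x, hx⟩ := cauchySeq_tendsto_of_complete hc
  have hle : ∀ n, dist x (u (w n)) ≤ (1 / 2) ^ n := fun n =>
    le_of_tendsto_of_tendsto' (hx.dist tendsto_const_nhds)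
      (by simpa using h0.add_const ((1 / 2 : ℝ) ^ n)) fun m => (hd m n).le
  refine ⟨x, fun n => ?_⟩
  obtain ⟨m, hm, -⟩ := h n n
  obtain ⟨r, rfl, hr⟩ := confirms_streamPrefix.1 hm
  linarith [hle r, dist_triangle x (u (w r)) (u (w n))]

/-- A fixed precision suffices to select computably a digit whose range contains a neighbourhood
of the given point. -/
theorem exists_digit_selector (hX : IsDigitSpace d) (hwc : IsWellCovering d)
    (hdec : IsDecidableDigitSpace d u) : ∃ (n₀ : ℕ) (δ : ℕ → Fin k), Computable δ ∧
      ∀ (x y : X) (a : ℕ), dist x (u a) < (1 / 2) ^ n₀ → dist x y < (1 / 2) ^ n₀ →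
        y ∈ Set.range (d (δ a)) := by
  have := hX.nonempty_digit
  have := hX.compactSpace
  obtain ⟨ε, hε, hcov⟩ := lebesgue_number_lemma_of_metric (isCompact_univ (X := X))
    (c := fun i => interior (Set.range (d i))) (fun i => isOpen_interior)
    (fun x _ => Set.mem_iUnion.2 (hwc x))
  obtain ⟨e, he⟩ := exists_pow_lt_of_lt_one (half_pos hε) (show (1 / 2 : ℝ) < 1 by norm_num)
  have hp : ComputablePred fun p : ℕ × Fin k =>
      Metric.ball (u p.1) ((1 / 2) ^ e) ⊆ Set.range (d p.2) := by
    obtain ⟨f, hf, hfe⟩ := ComputablePred.computable_iff.1 hdec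
    refine ComputablePred.computable_iff.2 ⟨fun p => f (p.1, halfPow e, p.2), hf.comp
      (Computable.fst.pair ((Computable.const _).pair Computable.snd)), funext fun p => ?_⟩
    have := congrFun hfe (p.1, halfPow e, p.2)
    rwa [posRat_halfPow] at this
  obtain ⟨δ, hδ, hsel⟩ := hp.exists_choice
  -- The ball of radius `2⁻ᵉ` about an entry within `2⁻⁽ᵉ⁺¹⁾` of `x` contains everything that near
  -- to `x`, yet stays inside the Lebesgue ball about `x`, as `2⁻ᵉ < ε / 2`.
  refine ⟨e + 1, δ, hδ, fun x y a hxa hxy => ?_⟩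
  have hpow : (1 / 2 : ℝ) ^ (e + 1) + (1 / 2) ^ (e + 1) = (1 / 2) ^ e := by ring
  have hpos : (0 : ℝ) < (1 / 2) ^ (e + 1) := by positivity
  obtain ⟨i, hi⟩ := hcov x (Set.mem_univ x)
  refine hsel a i (fun z hz => interior_subset (hi ?_)) ?_
  · rw [Metric.mem_ball] at hz ⊢
    linarith [dist_triangle z (u a) x, dist_comm x (u a)]
  · rw [Metric.mem_ball]
    linarith [dist_triangle_left y (u a) x]

/-- Approximable choice turns a name of `x` into a name of a preimage of `x`. -/
theorem exists_preimage_name [CompactSpace X] {f : X → X} (hf : Continuous f)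
    {v : (ℕ × ℕ) × ℕ →. ℕ} {m : ℕ × ℕ → ℕ × ℕ}
    (hdom : ∀ θ j, u j ∈ Set.range f → (v (θ, j)).Dom)
    (hmax : ∀ θ θ' j, u j ∈ Set.range f → ∀ a ∈ v (θ, j), ∀ b ∈ v (θ', j),
      dist (u a) (u b) < max (posRat θ : ℝ) (posRat θ' : ℝ))
    (hm : ∀ θ j j', u j ∈ Set.range f → u j' ∈ Set.range f →
      dist (u j) (u j') < (posRat (m θ) : ℝ) →
        ∀ a ∈ v (θ, j), ∀ b ∈ v (θ, j'), dist (u a) (u b) < (posRat θ : ℝ))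
    (hz : ∀ θ j, u j ∈ Set.range f → ∀ a ∈ v (θ, j),
      ∃ z : X, f z = u j ∧ dist z (u a) < (posRat θ : ℝ))
    {w : ℕ → ℕ} {x : X} (hx : ∀ n, dist x (u (w n)) < (1 / 2) ^ n) {n₀ : ℕ}
    (hr : ∀ n, n₀ ≤ n → u (w n) ∈ Set.range f) :
    ∃ z, f z = x ∧ ∀ n, ∃ a ∈ v (halfPow (n + 2), w (n₀ + (m (halfPow (n + 2))).2 + 1)),
      dist z (u a) < (1 / 2) ^ n := by
  have hA : ∀ l j, ∃ a, n₀ ≤ j → a ∈ v (halfPow l, w j) := by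
    intro l j
    by_cases hj : n₀ ≤ j
    · exact ⟨_, fun _ => Part.get_mem (hdom (halfPow l) (w j) (hr j hj))⟩
    · exact ⟨0, fun h => absurd h hj⟩
  choose A hA using hA
  -- Exact preimages of the entries need not converge, but by compactness a subsequence does, and
  -- continuity puts its limit over `x`.
  choose z hzf hzA using fun l =>
    hz (halfPow l) _ (hr (n₀ + l) (by omega)) _ (hA l (n₀ + l) (by omega))
  obtain ⟨z₀, φ, hφ, hlim⟩ := CompactSpace.tendsto_subseq z
  have h0 : Filter.Tendsto (fun n : ℕ => (1 / 2 : ℝ) ^ n) Filter.atTop (nhds 0) :=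
    tendsto_pow_atTop_nhds_zero_of_lt_one (by norm_num) (by norm_num)
  have hw : Filter.Tendsto (fun n => u (w n)) Filter.atTop (nhds x) := by
    refine tendsto_iff_dist_tendsto_zero.2 (squeeze_zero (fun _ => dist_nonneg) (fun n => ?_) h0)
    rw [dist_comm]; exact (hx n).le
  refine ⟨z₀, ?_, fun n => ?_⟩
  · refine tendsto_nhds_unique ((hf.tendsto z₀).comp hlim) ?_
    have h1 : Filter.Tendsto (fun l => n₀ + φ l) Filter.atTop Filter.atTop :=
      Filter.tendsto_atTop_mono (fun l => Nat.le_add_left _ _) hφ.tendsto_atTop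
    exact (hw.comp h1).congr fun l => (hzf (φ l)).symm
  · set b := (m (halfPow (n + 2))).2 with hb
    refine ⟨_, hA (n + 2) (n₀ + b + 1) (by omega), ?_⟩
    -- Three errors of at most `2⁻⁽ⁿ⁺²⁾`: from preimage to its approximation, from precision `φ l`
    -- to `n + 2`, and from entry `n₀ + φ l` to `n₀ + b + 1`. The sum is three quarters of `2⁻ⁿ`, so
    -- strictness survives the limit.
    have hle : dist z₀ (u (A (n + 2) (n₀ + b + 1))) ≤ 3 * (1 / 2) ^ (n + 2) := by
      refine le_of_tendsto (hlim.dist tendsto_const_nhds) ?_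
      filter_upwards [hφ.tendsto_atTop.eventually_ge_atTop (n + 2 + (b + 1))] with l hl
      simp only [Function.comp]
      have h1 := hzA (φ l)
      have h2 := hmax _ _ _ (hr (n₀ + φ l) (by omega)) _ (hA (φ l) (n₀ + φ l) (by omega)) _
        (hA (n + 2) (n₀ + φ l) (by omega))
      have h3 := hm (halfPow (n + 2)) _ _ (hr (n₀ + φ l) (by omega)) (hr (n₀ + b + 1) (by omega))
        (by
          have h4 := two_mul_half_pow_le_posRat (m (halfPow (n + 2)))
          rw [← hb] at h4
          linarith [dist_triangle_left (u (w (n₀ + φ l))) (u (w (n₀ + b + 1))) x, hx (n₀ + φ l),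
            hx (n₀ + b + 1), half_pow_le_half_pow (show b + 1 ≤ n₀ + φ l by omega),
            half_pow_le_half_pow (show b + 1 ≤ n₀ + b + 1 by omega)])
        _ (hA (n + 2) (n₀ + φ l) (by omega)) _ (hA (n + 2) (n₀ + b + 1) (by omega))
      have hφn := half_pow_le_half_pow (show n + 2 ≤ φ l by omega)
      simp only [posRat_halfPow] at h1 h2 h3
      rw [max_eq_right hφn] at h2
      linarith [dist_triangle (z (φ l)) (u (A (φ l) (n₀ + φ l))) (u (A (n + 2) (n₀ + b + 1))),
        dist_triangle (u (A (φ l) (n₀ + φ l))) (u (A (n + 2) (n₀ + φ l)))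
          (u (A (n + 2) (n₀ + b + 1)))]
    have hpos : (0 : ℝ) < (1 / 2) ^ n := by positivity
    have : 3 * (1 / 2 : ℝ) ^ (n + 2) = 3 / 4 * (1 / 2) ^ n := by ring
    linarith

/-- The invariant of the iteration. `β` need only agree with whatever digits appear, so the lemma
serves both to show that all digits appear and to evaluate a given output. Facts witnessed by
different prefixes are brought to a common one by monotonicity. -/
theorem exists_remainder {V M : Fin k → Nat.Partrec.Code} {δ : ℕ → Fin k} {n₀ : ℕ}
    {c₀ : Nat.Partrec.Code}
    (hc₀ : ∀ (s : List ℕ) n, c₀.eval (Nat.pair (Encodable.encode s) n) = (s[n]? : Part ℕ))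
    (hstep : ∀ (x : X) (w : ℕ → ℕ), (∀ n, dist x (u (w n)) < (1 / 2) ^ n) →
      ∃ z, d (δ (w n₀)) z = x ∧ ∃ w' : ℕ → ℕ, (∀ n, dist z (u (w' n)) < (1 / 2) ^ n) ∧
        ∀ n, ∃ r ∈ (M (δ (w n₀))).eval n, w' n ∈ (V (δ (w n₀))).eval (Nat.pair n (w r)))
    (hmono : IsMonotoneCode c₀) {x : X} {w : ℕ → ℕ} (hx : ∀ n, dist x (u (w n)) < (1 / 2) ^ n)
    {β : ℕ → Fin k}
    (hβ : ∀ j m, ∀ i ∈ remainderDigit V M δ n₀ c₀ (streamPrefix w m) j, β j = i) (j : ℕ) :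
    ∃ (y : X) (w' : ℕ → ℕ) (c : Nat.Partrec.Code),
      (∃ m, c ∈ remainderCode V M δ n₀ c₀ (streamPrefix w m) j) ∧
      (∀ n, dist y (u (w' n)) < (1 / 2) ^ n) ∧
      (∀ n, ∃ m, w' n ∈ c.eval (Nat.pair (Encodable.encode (streamPrefix w m)) n)) ∧
      (∃ m, δ (w' n₀) ∈ remainderDigit V M δ n₀ c₀ (streamPrefix w m) j) ∧
      digitComp d (streamPrefix β j) y = x := by
  have hdigit : ∀ (w' : ℕ → ℕ) (c : Nat.Partrec.Code) (j m₁ m₂ : ℕ),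
      c ∈ remainderCode V M δ n₀ c₀ (streamPrefix w m₁) j →
      w' n₀ ∈ c.eval (Nat.pair (Encodable.encode (streamPrefix w m₂)) n₀) →
      c ∈ remainderCode V M δ n₀ c₀ (streamPrefix w (max m₁ m₂)) j ∧
      w' n₀ ∈ c.eval (Nat.pair (Encodable.encode (streamPrefix w (max m₁ m₂))) n₀) := by
    intro w' c j m₁ m₂ h₁ h₂
    exact ⟨remainderCode_mono hmono (streamPrefix_prefix w (le_max_left _ _)) j _ h₁,
      isMonotoneCode_of_mem_remainderCode hmono j _ h₁
        (streamPrefix_prefix w (le_max_right _ _)) _ _ h₂⟩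
  induction j with
  | zero =>
    have h : ∀ n, w n ∈ c₀.eval (Nat.pair (Encodable.encode (streamPrefix w (n + 1))) n) := by
      intro n
      rw [hc₀, streamPrefix_getElem? w (Nat.lt_succ_self n)]
      exact Part.mem_some _
    exact ⟨x, w, c₀, ⟨0, Part.mem_some _⟩, hx, fun n => ⟨n + 1, h n⟩,
      ⟨n₀ + 1, Part.mem_bind_iff.2 ⟨c₀, Part.mem_some _, Part.mem_bind_iff.2
        ⟨_, h n₀, Part.mem_some _⟩⟩⟩, rfl⟩
  | succ j ih =>
    obtain ⟨y, w', c, ⟨m₁, h₁⟩, hy, hw', ⟨m₃, h₃⟩, hyx⟩ := ih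
    obtain ⟨m₂, h₂⟩ := hw' n₀
    obtain ⟨h₁', h₂'⟩ := hdigit w' c j m₁ m₂ h₁ h₂
    obtain ⟨z, hz, w'', hw'', hr⟩ := hstep y w' hy
    set i := δ (w' n₀) with hi
    have hcode : refineCode (V i) (M i) c ∈
        remainderCode V M δ n₀ c₀ (streamPrefix w (max m₁ m₂)) (j + 1) :=
      Part.mem_bind_iff.2 ⟨c, h₁', Part.mem_bind_iff.2 ⟨_, h₂', Part.mem_some _⟩⟩
    have hname : ∀ n, ∃ m, w'' n ∈ (refineCode (V i) (M i) c).eval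
        (Nat.pair (Encodable.encode (streamPrefix w m)) n) := by
      intro n
      obtain ⟨r, hrM, hrV⟩ := hr n
      obtain ⟨m, hm⟩ := hw' r
      refine ⟨m, ?_⟩
      rw [eval_refineCode]
      exact Part.mem_bind_iff.2 ⟨r, hrM, Part.mem_bind_iff.2 ⟨_, hm, hrV⟩⟩
    obtain ⟨m₄, h₄⟩ := hname n₀
    obtain ⟨h₅, h₆⟩ := hdigit w'' _ (j + 1) _ m₄ hcode h₄
    refine ⟨z, w'', _, ⟨_, hcode⟩, hw'', hname,
      ⟨_, Part.mem_bind_iff.2 ⟨_, h₅, Part.mem_bind_iff.2 ⟨_, h₆, Part.mem_some _⟩⟩⟩, ?_⟩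
    rw [streamPrefix_succ, digitComp_append, hβ j m₃ _ h₃, ← hyx, ← hz]
    rfl

end

/-! ### Assembling the two operators -/

theorem IsComputableDigitSpace.exists_digitization {X : Type*} [MetricSpace X] {k : ℕ}
    {d : Fin k → X → X} {u : ℕ → X} (hX : IsComputableDigitSpace d u) (hwc : IsWellCovering d)
    (hdec : IsDecidableDigitSpace d u) (hac : HasApproximableChoice d u) :
    ∃ G : (ℕ → ℕ) →. (ℕ → Fin k), IsComputableOperator G ∧ G.Dom = (cauchyRep u).Dom ∧
      ∀ w, ∀ β ∈ G w, hX.toIsDigitSpace.val β ∈ cauchyRep u w := by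
  have := hX.compactSpace
  have := hX.complete
  obtain ⟨i₀⟩ := hX.nonempty_digit
  obtain ⟨n₀, δ, hδ, hsel⟩ := exists_digit_selector hX.toIsDigitSpace hwc hdec
  choose v hv hdom hmax hunif hpre using hac
  choose m hm hunif using hunif
  have hV : ∀ i, Partrec fun q : ℕ × ℕ => v i (halfPow (q.1 + 2), q.2) := fun i =>
    (hv i).comp (((primrec_halfPow.comp (Primrec.nat_add.comp .fst (Primrec.const 2))).pair
      .snd).to_comp)
  have hM : ∀ i, Computable fun n : ℕ => n₀ + (m i (halfPow (n + 2))).2 + 1 := fun i =>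
    Computable.succ.comp (Primrec.nat_add.to_comp.comp (Computable.const n₀)
      (Computable.snd.comp ((hm i).comp
        (primrec_halfPow.comp (Primrec.nat_add.comp .id (Primrec.const 2))).to_comp)))
  choose V hV using fun i => (hV i).exists_code
  choose M hM using fun i => Partrec.exists_code (hM i).partrec
  obtain ⟨c₀, hc₀⟩ := Partrec.exists_code
    (Primrec.list_getElem? (α := ℕ)).to_comp.ofOption
  replace hc₀ : ∀ (s : List ℕ) n,
      c₀.eval (Nat.pair (Encodable.encode s) n) = (s[n]? : Part ℕ) := by
    intro s n
    have h := hc₀ (s, n)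
    rw [Encodable.encode_prod_val] at h
    refine h.trans ?_
    change Part.map id _ = _
    exact Part.map_id' (fun _ => rfl) _
  have hmono : IsMonotoneCode c₀ := by
    rintro s t ⟨r, rfl⟩ n a ha
    rw [hc₀, Part.mem_ofOption, Option.mem_def] at ha ⊢
    obtain ⟨h, -⟩ := List.getElem?_eq_some_iff.1 ha
    rwa [List.getElem?_append_left h]
  have hstep : ∀ (x : X) (w : ℕ → ℕ), (∀ n, dist x (u (w n)) < (1 / 2) ^ n) →
      ∃ z, d (δ (w n₀)) z = x ∧ ∃ w' : ℕ → ℕ, (∀ n, dist z (u (w' n)) < (1 / 2) ^ n) ∧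
        ∀ n, ∃ r ∈ (M (δ (w n₀))).eval n, w' n ∈ (V (δ (w n₀))).eval (Nat.pair n (w r)) := by
    intro x w hx
    set i := δ (w n₀)
    obtain ⟨q, -, -, hq⟩ := hX.exists_common_factor
    have hcont : Continuous (d i) := (LipschitzWith.of_dist_le_mul (K := ⟨max q 0, by simp⟩)
      (fun x y => (hq i x y).trans
        (mul_le_mul_of_nonneg_right (le_max_left _ _) dist_nonneg))).continuous
    obtain ⟨z, hz, hzn⟩ := exists_preimage_name hcont (hdom i) (hmax i) (hunif i) (hpre i) hx
      (n₀ := n₀) (fun n hn => hsel x _ _ (hx n₀) ((hx n).trans_le (half_pow_le_half_pow hn)))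
    choose w' hw' hzw' using hzn
    refine ⟨z, hz, w', hzw', fun n => ⟨n₀ + (m i (halfPow (n + 2))).2 + 1, ?_, ?_⟩⟩
    · have h := hM i n
      rw [Encodable.encode_nat] at h
      rw [h]
      exact Part.mem_some _
    · have h := hV i (n, w (n₀ + (m i (halfPow (n + 2))).2 + 1))
      rw [Encodable.encode_prod_val] at h
      change (V i).eval (Nat.pair n (w (n₀ + (m i (halfPow (n + 2))).2 + 1))) = _ at h
      rw [h]
      exact Part.mem_map Encodable.encode (hw' n)
  -- As `n` runs through all numbers, every pair of entries gets tested, which cuts the domain down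
  -- to Cauchy names. The test need not persist under extension; only the agreement of produced
  -- digits matters.
  let Φ : List ℕ × ℕ →. Fin k := fun p =>
    (Part.assert (Confirms u p.1 p.2.unpair.1 ∧ Confirms u p.1 p.2.unpair.2)
      fun _ => Part.some ()).bind fun _ => remainderDigit V M δ n₀ c₀ p.1 p.2
  have hmem : ∀ s n i, i ∈ Φ (s, n) ↔ (Confirms u s n.unpair.1 ∧ Confirms u s n.unpair.2) ∧
      i ∈ remainderDigit V M δ n₀ c₀ s n := by
    intro s n i
    simp [Φ, Part.mem_bind_iff]
  have hΦ : Partrec Φ := by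
    have hre : REPred fun p : List ℕ × ℕ =>
        Confirms u p.1 p.2.unpair.1 ∧ Confirms u p.1 p.2.unpair.2 :=
      (hX.computableMetric.rePred_confirms.comp (Primrec.fst.pair
        (Primrec.fst.comp (Primrec.unpair.comp .snd))).to_comp).and
      (hX.computableMetric.rePred_confirms.comp (Primrec.fst.pair
        (Primrec.snd.comp (Primrec.unpair.comp .snd))).to_comp)
    exact Partrec.bind hre ((partrec_remainderDigit hδ).comp Computable.fst).to₂
  have hdet : ∀ (s t : List ℕ) (n : ℕ) (a b : Fin k), s <+: t →
      a ∈ remainderDigit V M δ n₀ c₀ s n → b ∈ remainderDigit V M δ n₀ c₀ t n → a = b :=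
    fun s t n a b hst ha hb => Part.mem_unique (remainderDigit_mono hmono hst n a ha) hb
  have hdet' : ∀ (w : ℕ → ℕ) (r r' n : ℕ) (a b : Fin k),
      a ∈ remainderDigit V M δ n₀ c₀ (streamPrefix w r) n →
      b ∈ remainderDigit V M δ n₀ c₀ (streamPrefix w r') n → a = b := by
    intro w r r' n a b ha hb
    rcases le_total r r' with h | h
    · exact hdet _ _ n a b (streamPrefix_prefix w h) ha hb
    · exact (hdet _ _ n b a (streamPrefix_prefix w h) hb ha).symm
  obtain ⟨G, hG, hGΦ⟩ := isComputableOperator_mk hΦ fun s t n a b hst ha hb =>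
    hdet s t n a b hst ((hmem _ _ _).1 ha).2 ((hmem _ _ _).1 hb).2
  have hlim : ∀ w, ∀ β ∈ G w, ∃ x, ∀ n, dist x (u (w n)) < (1 / 2) ^ n := by
    intro w β hβ
    refine exists_limit_of_confirms fun i j => ?_
    obtain ⟨r, hr⟩ := (hGΦ w β).1 hβ (Nat.pair i j)
    have h := ((hmem _ _ _).1 hr).1
    rw [Nat.unpair_pair] at h
    exact ⟨r, h⟩
  refine ⟨G, hG, Set.ext fun w => ⟨fun h => ?_, fun h => ?_⟩, fun w β hβ => ?_⟩
  · exact hlim w _ (Part.get_mem h)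
  · obtain ⟨x, hx⟩ : ∃ x, ∀ n, dist x (u (w n)) < (1 / 2) ^ n := h
    -- The default `i₀` stands in until `exists_remainder`, applied to this very `β`, shows that
    -- every digit is produced.
    have hβ : ∀ j, ∃ b, ∀ r, ∀ i ∈ remainderDigit V M δ n₀ c₀ (streamPrefix w r) j, b = i := by
      intro j
      by_cases h : ∃ r, ∃ i, i ∈ remainderDigit V M δ n₀ c₀ (streamPrefix w r) j
      · obtain ⟨r, i, hi⟩ := h
        exact ⟨i, fun r' i' hi' => hdet' w r r' j i i' hi hi'⟩
      · exact ⟨i₀, fun r i hi => (h ⟨r, i, hi⟩).elim⟩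
    choose β hβ using hβ
    suffices hmemG : β ∈ G w from Part.dom_iff_mem.2 ⟨β, hmemG⟩
    refine (hGΦ w β).2 fun n => ?_
    obtain ⟨y, w', c, -, -, -, ⟨r, hr⟩, -⟩ := exists_remainder hc₀ hstep hmono hx hβ n
    obtain ⟨r', hr', h₁, h₂⟩ := ((Filter.eventually_ge_atTop r).and
      ((confirms_eventually hx n.unpair.1).and (confirms_eventually hx n.unpair.2))).exists
    refine ⟨r', (hmem _ _ _).2 ⟨⟨h₁, h₂⟩, ?_⟩⟩
    rw [hβ n r _ hr]
    exact remainderDigit_mono hmono (streamPrefix_prefix w hr') n _ hr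
  · obtain ⟨x, hx⟩ := hlim w β hβ
    have hβ' : ∀ j r, ∀ i ∈ remainderDigit V M δ n₀ c₀ (streamPrefix w r) j, β j = i := by
      intro j r i hi
      obtain ⟨r', hr'⟩ := (hGΦ w β).1 hβ j
      exact hdet' w r' r j _ _ ((hmem _ _ _).1 hr').2 hi
    have hval : hX.toIsDigitSpace.val β = x := hX.toIsDigitSpace.eq_val fun n => by
      obtain ⟨y, -, -, -, -, -, -, hy⟩ := exists_remainder hc₀ hstep hmono hx hβ' n
      exact ⟨y, hy⟩
    rw [hval]
    exact mem_cauchyRep.2 hx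

theorem mainTheorem7 {X : Type*} [MetricSpace X] {k : ℕ} (d : Fin k → X → X) (u : ℕ → X)
    (hX : IsComputableDigitSpace d u) (hwc : IsWellCovering d)
    (hdec : IsDecidableDigitSpace d u) (hac : HasApproximableChoice d u) :
    ∃ (F : (ℕ → Fin k) → (ℕ → ℕ)) (G : (ℕ → ℕ) →. (ℕ → Fin k)),
      IsComputableOperator (fun α => Part.some (F α)) ∧
      IsComputableOperator G ∧
      (∀ α, hX.toIsDigitSpace.val α ∈ cauchyRep u (F α)) ∧
      G.Dom = (cauchyRep u).Dom ∧
      ∀ w, ∀ β ∈ G w, hX.toIsDigitSpace.val β ∈ cauchyRep u w := by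
  obtain ⟨F, hF, hFval⟩ := hX.exists_evaluation
  obtain ⟨G, hG, hdom, hGval⟩ := hX.exists_digitization hwc hdec hac
  exact ⟨F, G, hF, hG, fun α => mem_cauchyRep.2 (hFval α), hdom, hGval⟩
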